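/- Let $C\subset\mathbb{P}^2_{\mathbb{C}}$ be a reduced curve of even degree $n\ge 6$ all of whose singular points are simple, i.e. of type $A_k$ ($k\ge1$), $D_k$ ($k\ge4$), $E_6$, $E_7$ or $E_8$. For a singular point $p$ of $C$, let $m(p)$ be the Miyaoka--Kobayashi number of the rational double point of the same type $\mathbb{C}^2/G_p$ lying over $p$ on the double cover of $\mathbb{P}^2_{\mathbb{C}}$ branched along $C$, that is $$m(p)=3\left(e(E_p)-\frac{1}{|G_p|}\right)-K(E_p)^2,$$ where $G_p\subset GL(2,\mathbb{C})$ is the corresponding small finite group, $E_p$ is the exceptional divisor of the minimal resolution, $e(E_p)$ its topological Euler characteristic, and $K(E_p)$ the local canonical divisor. The curve $C$ is called an MK-curve if $$\sum_{p\in\mathrm{Sing}(C)}m(p)=\frac n2(5n-6).$$ Then there is no MK-curve of degree $10$ all of whose singular points are nodes ($A_1$), tacnodes ($A_3$) or ordinary triple points ($D_4$). Moreover, the Diophantine equation $$\frac92 n_1+\frac{45}{4}n_3+\frac{117}{8}d_4=220$$ has no solution in nonnegative integers $n_1,n_3,d_4$. -/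

import Mathlib

noncomputable section

open scoped Topology LinearAlgebra.Projectivization

namespace MKCurve

/-! ### Miyaoka-Kobayashi numbers of quotient surface singularities

The exceptional divisor `E` of the minimal resolution of a quotient surface singularity is a normal
crossing configuration of smooth rational curves `E_1, …, E_r` (any two of them meeting in at most
one point). It is recorded by the intersection matrix `M i j = E_i · E_j`. -/

/-- The topological Euler characteristic `e(E)`: each `E_i` is a 2-sphere, and each crossing point
lies on exactly two of the curves. -/
def eulerChar {r : ℕ} (M : Matrix (Fin r) (Fin r) ℤ) : ℤ :=
  2 * (r : ℤ) - ∑ i, ∑ j, if i < j then M i j else 0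

/-- Coefficients of the local canonical divisor `K(E) = ∑ a_i E_i`, the rational cycle supported on
`E` determined by the adjunction formula `K(E) · E_j = -2 - E_j · E_j` for all `j`. -/
def localCanonical {r : ℕ} (M : Matrix (Fin r) (Fin r) ℤ) : Fin r → ℚ :=
  Matrix.mulVec (M.map (Int.cast : ℤ → ℚ))⁻¹ (fun j => -2 - (M j j : ℚ))

/-- The self-intersection `K(E)²` of the local canonical divisor. -/
def localCanonicalSq {r : ℕ} (M : Matrix (Fin r) (Fin r) ℤ) : ℚ :=
  dotProduct (localCanonical M) (Matrix.mulVec (M.map (Int.cast : ℤ → ℚ)) (localCanonical M))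

/-- The Miyaoka-Kobayashi number `3 (e(E) - 1 / ord G) - K(E)²` of a quotient surface singularity
`ℂ² / G`, where `G` is a small subgroup of `GL(2, ℂ)` and `M` is the intersection matrix of the
exceptional divisor of the minimal resolution. -/
def miyaokaKobayashi {r : ℕ} (M : Matrix (Fin r) (Fin r) ℤ)
    (G : Subgroup (Matrix.GeneralLinearGroup (Fin 2) ℂ)) : ℚ :=
  3 * ((eulerChar M : ℚ) - 1 / (Nat.card G : ℚ)) - localCanonicalSq M

/-! ### Simple (ADE) singularities -/

/-- The types of simple singularities: `A_k` for `k ≥ 1`, `D_k` for `k ≥ 4`, `E_6`, `E_7`, `E_8`. -/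
inductive ADEType : Type
  | A (k : ℕ) (hk : 1 ≤ k)
  | D (k : ℕ) (hk : 4 ≤ k)
  | E6
  | E7
  | E8

/-- The number of exceptional curves of the minimal resolution. -/
def ADEType.rank : ADEType → ℕ
  | .A k _ => k
  | .D k _ => k
  | .E6 => 6
  | .E7 => 7
  | .E8 => 8

/-- The exceptional curves of the minimal resolution of a rational double point are `(-2)`-curves
whose dual graph is the Dynkin diagram of the same name: the intersection matrix is minus the
Cartan matrix. -/
def ADEType.intersectionMatrix : (T : ADEType) → Matrix (Fin T.rank) (Fin T.rank) ℤ
  | .A k _ => -CartanMatrix.A k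
  | .D k _ => -CartanMatrix.D k
  | .E6 => -CartanMatrix.E₆
  | .E7 => -CartanMatrix.E₇
  | .E8 => -CartanMatrix.E₈

/-- The matrix `diag(ζ, ζ⁻¹)` with `ζ = exp(2πi / N)`. -/
def rotationMatrix (N : ℕ) : Matrix (Fin 2) (Fin 2) ℂ :=
  !![Complex.exp (2 * Real.pi * Complex.I / N), 0;
     0, Complex.exp (-(2 * Real.pi * Complex.I / N))]

/-- The quaternion `a + b i + c j + d k` as a complex matrix. -/
def quaternionMatrix (a b c d : ℝ) : Matrix (Fin 2) (Fin 2) ℂ :=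
  !![a + b * Complex.I, c + d * Complex.I;
     -c + d * Complex.I, a - b * Complex.I]

/-- Generators of the small group of a rational double point: the cyclic group of order `k + 1`, the
binary dihedral group of order `4 (k - 2)`, and the binary tetrahedral, octahedral and icosahedral
groups, of orders 24, 48 and 120, in `SL(2, ℂ)`. -/
def ADEType.groupGenerators : ADEType → Set (Matrix (Fin 2) (Fin 2) ℂ)
  | .A k _ => {rotationMatrix (k + 1)}
  | .D k _ => {rotationMatrix (2 * (k - 2)), quaternionMatrix 0 0 1 0}
  | .E6 => {rotationMatrix 4, quaternionMatrix 0 0 1 0, quaternionMatrix (1 / 2) (1 / 2) (1 / 2) (1 / 2)}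
  | .E7 => {rotationMatrix 8, quaternionMatrix 0 0 1 0, quaternionMatrix (1 / 2) (1 / 2) (1 / 2) (1 / 2)}
  | .E8 => {quaternionMatrix (Real.goldenRatio / 2) (Real.goldenRatio⁻¹ / 2) (1 / 2) 0,
      quaternionMatrix (1 / 2) (1 / 2) (1 / 2) (1 / 2)}

/-- The small group `G` of the rational double point `ℂ² / G` of the given type. -/
def ADEType.smallGroup (T : ADEType) : Subgroup (Matrix.GeneralLinearGroup (Fin 2) ℂ) :=
  Subgroup.closure {g | (g : Matrix (Fin 2) (Fin 2) ℂ) ∈ T.groupGenerators}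

/-- The Miyaoka-Kobayashi number of the surface singularity of the given type. -/
def ADEType.mkNumber (T : ADEType) : ℚ :=
  miyaokaKobayashi T.intersectionMatrix T.smallGroup

/-- The normal form of the plane curve singularity of the given type; the surface singularity of the
same type is the double cover `w² = normalForm (x, y)`. -/
def ADEType.normalForm : ADEType → ℂ × ℂ → ℂ
  | .A k _ => fun z => z.1 ^ (k + 1) + z.2 ^ 2
  | .D k _ => fun z => z.1 ^ 2 * z.2 + z.2 ^ (k - 1)
  | .E6 => fun z => z.1 ^ 3 + z.2 ^ 4
  | .E7 => fun z => z.1 ^ 3 + z.1 * z.2 ^ 3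
  | .E8 => fun z => z.1 ^ 3 + z.2 ^ 5

/-- The germs at the origin of the curves `f = 0` and `g = 0` are isomorphic (contact equivalence):
near `0` one has `f = u · (g ∘ φ)` with a nowhere vanishing holomorphic function `u` and a local
biholomorphism `φ` fixing the origin. -/
def GermEquivalent (f g : ℂ × ℂ → ℂ) : Prop :=
  ∃ (φ : ℂ × ℂ → ℂ × ℂ) (L : (ℂ × ℂ) ≃L[ℂ] (ℂ × ℂ)) (u : ℂ × ℂ → ℂ),
    AnalyticAt ℂ φ 0 ∧ φ 0 = 0 ∧ HasFDerivAt φ (L : (ℂ × ℂ) →L[ℂ] (ℂ × ℂ)) 0 ∧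
    AnalyticAt ℂ u 0 ∧ u 0 ≠ 0 ∧ ∀ᶠ z in 𝓝 (0 : ℂ × ℂ), f z = u z * g (φ z)

/-! ### Plane curves `F = 0`, with `F` a form in three variables -/

/-- The singular points of the projective plane curve `F = 0`. -/
def singularPoints (F : MvPolynomial (Fin 3) ℂ) : Set (ℙ ℂ (Fin 3 → ℂ)) :=
  {p | MvPolynomial.eval p.rep F = 0 ∧ ∀ i, MvPolynomial.eval p.rep (MvPolynomial.pderiv i F) = 0}

/-- An index of a nonzero homogeneous coordinate of `p`. -/
def chartIndex (p : ℙ ℂ (Fin 3 → ℂ)) : Fin 3 :=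
  (Function.ne_iff.mp p.rep_nonzero).choose

/-- The local equation of `F = 0` at `p` in the affine chart where the coordinate with index
`chartIndex p` equals `1`, translated so that `p` is the origin of the chart. -/
def localEquation (F : MvPolynomial (Fin 3) ℂ) (p : ℙ ℂ (Fin 3 → ℂ)) (z : ℂ × ℂ) : ℂ :=
  MvPolynomial.eval ((p.rep (chartIndex p))⁻¹ • p.rep +
    ((chartIndex p).insertNth (0 : ℂ) ![z.1, z.2] : Fin 3 → ℂ)) F

/-- The curve `F = 0` has a singularity of type `T` at `p`. -/
def HasType (F : MvPolynomial (Fin 3) ℂ) (p : ℙ ℂ (Fin 3 → ℂ)) (T : ADEType) : Prop :=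
  GermEquivalent (localEquation F p) T.normalForm

/-- Nodes are the singularities of type `A_1`. -/
def IsNode (F : MvPolynomial (Fin 3) ℂ) (p : ℙ ℂ (Fin 3 → ℂ)) : Prop :=
  HasType F p (.A 1 le_rfl)

/-- Tacnodes are the singularities of type `A_3`. -/
def IsTacnode (F : MvPolynomial (Fin 3) ℂ) (p : ℙ ℂ (Fin 3 → ℂ)) : Prop :=
  HasType F p (.A 3 (by norm_num))

/-- Ordinary triple points are the singularities of type `D_4`. -/
def IsOrdinaryTriplePoint (F : MvPolynomial (Fin 3) ℂ) (p : ℙ ℂ (Fin 3 → ℂ)) : Prop :=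
  HasType F p (.D 4 le_rfl)

/-- All singularities of the curve are of type ADE. -/
def IsSimplySingular (F : MvPolynomial (Fin 3) ℂ) : Prop :=
  ∀ p ∈ singularPoints F, ∃ T, HasType F p T

open Classical in
/-- The Miyaoka-Kobayashi number `m(p)` of an ADE singularity `p` of the curve `F = 0`, i.e. of the
point over `p` of the double cover branched along the curve (the value `0` at points that are not
ADE singularities is never used). -/
def mkNumberAt (F : MvPolynomial (Fin 3) ℂ) (p : ℙ ℂ (Fin 3 → ℂ)) : ℚ :=
  if h : ∃ T, HasType F p T then h.choose.mkNumber else 0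

/-- `F = 0` is an MK-curve of degree `n`: a reduced simply singular curve of even degree `n ≥ 6`
with `∑ m(p) = (n / 2) (5 n - 6)`, the sum being over the (finitely many) singular points. -/
structure IsMKCurve (F : MvPolynomial (Fin 3) ℂ) (n : ℕ) : Prop where
  homogeneous : F.IsHomogeneous n
  reduced : Squarefree F
  even : Even n
  six_le : 6 ≤ n
  simplySingular : IsSimplySingular F
  sum_eq : ∑ᶠ p ∈ singularPoints F, mkNumberAt F p = (n : ℚ) / 2 * (5 * n - 6)

end MKCurve

end

open scoped Topology LinearAlgebra.Projectivization

namespace MKCurve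

/-! The obstruction is divisibility by 9. Rational double points have `K(E)² = 0`, and the groups
for A₁, A₃, D₄ have orders 2, 4, 8, so `m` is 9/2, 45/4, 117/8: all integral multiples of 9/8. In
degree 10 the sum would have to be 220, but 8 · 220 = 1760 ≡ 5 mod 9.

The longer part is that `mkNumberAt` chooses a type, so a germ of type A₁, A₃ or D₄ must be shown to
have no other type. Contact equivalence transports analytic arcs, preserving vanishing orders and
moving tangents by an invertible linear map (`GermEquivalent.exists_arc`); a well-chosen arc on the
known germ then excludes each competing normal form. -/

/-- Two germs that are contact equivalent to a common germ are contact equivalent. -/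
theorem GermEquivalent.of_common {f g h : ℂ × ℂ → ℂ} (hg : GermEquivalent f g)
    (hh : GermEquivalent f h) : GermEquivalent g h := by
  obtain ⟨φ, L, u, hφ, hφ0, hL, hu, hu0, hfg⟩ := hg
  obtain ⟨ψ, M, v, hψ, hψ0, hM, hv, hv0, hfh⟩ := hh
  have hstrict : HasStrictFDerivAt φ (L : (ℂ × ℂ) →L[ℂ] (ℂ × ℂ)) 0 := by
    have := hφ.hasStrictFDerivAt
    rwa [hL.fderiv] at this
  set R := hstrict.toOpenPartialHomeomorph φ with hR
  have hRφ : ∀ z, R z = φ z := fun z => rfl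
  have h0 : (0 : ℂ × ℂ) ∈ R.source := hstrict.mem_toOpenPartialHomeomorph_source
  have h0t : (0 : ℂ × ℂ) ∈ R.target := by
    have := R.map_source h0
    rwa [hRφ, hφ0] at this
  have hs0 : R.symm 0 = 0 := by
    have := R.left_inv h0
    rwa [hRφ, hφ0] at this
  have hsA : AnalyticAt ℂ R.symm 0 := by
    have := R.analyticAt_symm' (i := L) h0 hφ hL.fderiv
    rwa [hRφ, hφ0] at this
  have hsD : HasFDerivAt R.symm (L.symm : (ℂ × ℂ) →L[ℂ] (ℂ × ℂ)) 0 :=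
    R.hasFDerivAt_symm h0t (by rw [hs0]; exact hL)
  have hev : Filter.Tendsto R.symm (𝓝 0) (𝓝 0) := by
    simpa [ContinuousAt, hs0] using hsA.continuousAt
  -- From `u · (g ∘ φ) = v · (h ∘ ψ)`, substitute `φ⁻¹` and solve for `g`.
  refine ⟨ψ ∘ R.symm, L.symm.trans M, fun z => v (R.symm z) / u (R.symm z), ?_, ?_, ?_, ?_, ?_, ?_⟩
  · exact AnalyticAt.comp (by rwa [hs0]) hsA
  · simp [hs0, hψ0]
  · exact HasFDerivAt.comp (g := ψ) (0 : ℂ × ℂ) (by rwa [hs0]) hsD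
  · refine AnalyticAt.div ?_ ?_ (by rwa [hs0])
    · exact AnalyticAt.comp (g := v) (by rwa [hs0]) hsA
    · exact AnalyticAt.comp (g := u) (by rwa [hs0]) hsA
  · simp [hs0, hu0, hv0]
  · have hune : ∀ᶠ z in 𝓝 (0 : ℂ × ℂ), u z ≠ 0 := hu.continuousAt.eventually_ne hu0
    filter_upwards [hev.eventually hfg, hev.eventually hfh, hev.eventually hune,
      R.open_target.mem_nhds h0t] with z h1 h2 h3 h4
    have h5 : φ (R.symm z) = z := R.right_inv h4
    rw [h5] at h1
    rw [h1] at h2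
    simp only [Function.comp_apply]
    field_simp
    linear_combination h2

/-- A contact equivalence preserves the order of vanishing along analytic arcs through the origin,
and acts linearly on their tangent vectors. -/
theorem GermEquivalent.exists_arc {g h : ℂ × ℂ → ℂ} (hgh : GermEquivalent g h)
    (hh : AnalyticAt ℂ h 0) :
    ∃ L : (ℂ × ℂ) ≃L[ℂ] (ℂ × ℂ), ∀ γ : ℂ → ℂ × ℂ, AnalyticAt ℂ γ 0 → γ 0 = 0 →
      ∃ X Y : ℂ → ℂ, AnalyticAt ℂ X 0 ∧ AnalyticAt ℂ Y 0 ∧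
        1 ≤ analyticOrderAt X 0 ∧ 1 ≤ analyticOrderAt Y 0 ∧
        ((L (deriv γ 0)).1 ≠ 0 → analyticOrderAt X 0 = 1) ∧
        ((L (deriv γ 0)).2 ≠ 0 → analyticOrderAt Y 0 = 1) ∧
        analyticOrderAt (fun t => g (γ t)) 0 = analyticOrderAt (fun t => h (X t, Y t)) 0 := by
  obtain ⟨φ, L, u, hφ, hφ0, hL, hu, hu0, hfg⟩ := hgh
  refine ⟨L, fun γ hγ hγ0 => ?_⟩
  have hφγ : AnalyticAt ℂ (fun t => φ (γ t)) 0 := AnalyticAt.comp (g := φ) (by rwa [hγ0]) hγ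
  have hd : HasDerivAt (fun t => φ (γ t)) (L (deriv γ 0)) 0 :=
    HasFDerivAt.comp_hasDerivAt (l := φ) (l' := (L : (ℂ × ℂ) →L[ℂ] (ℂ × ℂ))) (0 : ℂ)
      (by rwa [hγ0]) hγ.differentiableAt.hasDerivAt
  have hX : AnalyticAt ℂ (fun t => (φ (γ t)).1) 0 := analyticAt_fst.comp hφγ
  have hY : AnalyticAt ℂ (fun t => (φ (γ t)).2) 0 := analyticAt_snd.comp hφγ
  have hX0 : (φ (γ 0)).1 = 0 := by simp [hγ0, hφ0]
  have hY0 : (φ (γ 0)).2 = 0 := by simp [hγ0, hφ0]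
  have hdX : HasDerivAt (fun t => (φ (γ t)).1) (L (deriv γ 0)).1 0 := hd.fst
  have hdY : HasDerivAt (fun t => (φ (γ t)).2) (L (deriv γ 0)).2 0 := hd.snd
  refine ⟨_, _, hX, hY, ?_, ?_, ?_, ?_, ?_⟩
  · exact Order.one_le_iff_ne_zero.2 (hX.analyticOrderAt_ne_zero.2 hX0)
  · exact Order.one_le_iff_ne_zero.2 (hY.analyticOrderAt_ne_zero.2 hY0)
  · exact fun hne => hX.analyticOrderAt_eq_one_of_zero_deriv_ne_zero hX0 (by rwa [hdX.deriv])
  · exact fun hne => hY.analyticOrderAt_eq_one_of_zero_deriv_ne_zero hY0 (by rwa [hdY.deriv])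
  · have huγ : AnalyticAt ℂ (fun t => u (γ t)) 0 := AnalyticAt.comp (g := u) (by rwa [hγ0]) hγ
    have hhγ : AnalyticAt ℂ (fun t => h (φ (γ t))) 0 :=
      AnalyticAt.comp (g := h) (by rwa [hγ0, hφ0]) hφγ
    have hev : Filter.Tendsto γ (𝓝 0) (𝓝 0) := by
      simpa [ContinuousAt, hγ0] using hγ.continuousAt
    rw [analyticOrderAt_congr (g := (fun t => u (γ t)) * fun t => h (φ (γ t))) (hev.eventually hfg),
      analyticOrderAt_mul huγ hhγ, huγ.analyticOrderAt_eq_zero.2 (by rwa [hγ0]), zero_add]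

theorem ADEType.analyticAt_normalForm (T : ADEType) : AnalyticAt ℂ T.normalForm 0 := by
  have h1 : AnalyticAt ℂ (fun z : ℂ × ℂ => z.1) 0 := analyticAt_fst
  have h2 : AnalyticAt ℂ (fun z : ℂ × ℂ => z.2) 0 := analyticAt_snd
  cases T <;> simp only [ADEType.normalForm] <;> fun_prop

/-! ### Arcs separating the normal forms -/

/-- No germ of type `A_k` with `k` even is equivalent to one of type `A_{2s-1}`: only the latter
contains a smooth branch. -/
theorem not_germEquivalent_A_even {s k : ℕ} (hs : 1 ≤ s) (hk : 1 ≤ k) (hke : Even k) :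
    ¬ GermEquivalent (ADEType.A (2 * s - 1) (by omega)).normalForm (ADEType.A k hk).normalForm := by
  intro H
  obtain ⟨L, hL⟩ := H.exists_arc (ADEType.analyticAt_normalForm _)
  have hd1 : HasDerivAt (fun t : ℂ => t) 1 0 := hasDerivAt_id _
  have hd2 : HasDerivAt (fun t : ℂ => Complex.I * t ^ s) (Complex.I * (s * 0 ^ (s - 1))) 0 :=
    (by simpa using hasDerivAt_pow s (0 : ℂ) : HasDerivAt (fun t : ℂ => t ^ s) _ 0).const_mul _
  obtain ⟨X, Y, hX, hY, hX1, hY1, hXd, hYd, he⟩ :=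
    -- A smooth branch of `x^(2s) + y² = 0`. Its nonzero tangent makes one of `X`, `Y` have order 1.
    hL (fun t => (t, Complex.I * t ^ s)) (by fun_prop) (by simp; omega)
  have hne : L (deriv (fun t : ℂ => (t, Complex.I * t ^ s)) 0) ≠ 0 := by
    rw [(hd1.prodMk hd2).deriv]
    simp
  have hor : analyticOrderAt X 0 = 1 ∨ analyticOrderAt Y 0 = 1 := by
    by_contra! hcon
    exact hne (Prod.ext (not_not.1 (mt hXd hcon.1)) (not_not.1 (mt hYd hcon.2)))
  have htop : analyticOrderAt (X ^ (k + 1) + Y ^ 2) 0 = ⊤ := by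
    have : analyticOrderAt (fun t => (ADEType.A (2 * s - 1) (by omega)).normalForm
        (t, Complex.I * t ^ s)) 0 = ⊤ := by
      rw [analyticOrderAt_eq_top]
      refine Filter.Eventually.of_forall fun t => ?_
      have h2 : 2 * s - 1 + 1 = s * 2 := by omega
      simp only [ADEType.normalForm, h2, pow_mul, mul_pow, Complex.I_sq]
      ring
    rw [this] at he
    exact he.symm
  -- The sum vanishes identically, so `(k + 1) ord X = 2 ord Y`. As `k + 1` is odd and at least 3,
  -- neither order can be 1.
  have heq : analyticOrderAt (X ^ (k + 1)) 0 = analyticOrderAt (Y ^ 2) 0 := by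
    by_contra hcon
    rw [analyticOrderAt_add_of_ne hcon, min_eq_top] at htop
    exact hcon (htop.1.trans htop.2.symm)
  rw [analyticOrderAt_pow hX, analyticOrderAt_pow hY] at heq
  obtain ⟨c, rfl⟩ := hke
  generalize analyticOrderAt X 0 = a at *
  generalize analyticOrderAt Y 0 = b at *
  simp only [nsmul_eq_mul] at heq
  rcases hor with rfl | rfl
  · induction b using ENat.recTopCoe with
    | top =>
      rw [ENat.mul_top (by simp)] at heq
      exact ENat.natCast_ne_top (c + c + 1) (by simp at heq)
    | coe b => norm_cast at heq; omega
  · induction a using ENat.recTopCoe with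
    | top =>
      rw [ENat.mul_top (by simp)] at heq
      exact ENat.natCast_ne_top 2 (by simpa using heq.symm)
    | coe a =>
      norm_cast at heq hX1
      have := Nat.mul_le_mul_left (c + c + 1) hX1
      rw [heq] at this
      omega

/-- On some arc a germ of type `A_{2s-1}` vanishes to order `2s+1`, which is impossible for a germ
of type `A_k` with `k ≥ 2s + 1`. -/
theorem not_germEquivalent_A_of_lt {s k : ℕ} (hs : 1 ≤ s) (hk : 1 ≤ k) (hsk : 2 * s + 1 ≤ k) :
    ¬ GermEquivalent (ADEType.A (2 * s - 1) (by omega)).normalForm (ADEType.A k hk).normalForm := by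
  intro H
  obtain ⟨L, hL⟩ := H.exists_arc (ADEType.analyticAt_normalForm _)
  obtain ⟨X, Y, hX, hY, hX1, hY1, -, -, he⟩ :=
    -- A perturbed branch, on which the form equals `(2i + t) t^(2s+1)`. On the other side `X^(k+1)`
    -- has order at least `2s + 2`, so the odd order `2s + 1` would have to come from `Y²`.
    hL (fun t => (t, Complex.I * t ^ s + t ^ (s + 1))) (by fun_prop) (by simp; omega)
  have hord : analyticOrderAt (X ^ (k + 1) + Y ^ 2) 0 = (2 * s + 1 : ℕ) := by
    refine he.symm.trans ?_
    rw [AnalyticAt.analyticOrderAt_eq_natCast]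
    · refine ⟨fun t => 2 * Complex.I + t, by fun_prop, by simp, Filter.Eventually.of_forall ?_⟩
      intro t
      have h2 : 2 * s - 1 + 1 = s * 2 := by omega
      simp only [ADEType.normalForm, h2, sub_zero, smul_eq_mul]
      linear_combination (t ^ (s * 2)) * Complex.I_sq
    · simp only [ADEType.normalForm]
      fun_prop
  have hXo : ((2 * s + 2 : ℕ) : ℕ∞) ≤ analyticOrderAt (X ^ (k + 1)) 0 := by
    rw [analyticOrderAt_pow hX, nsmul_eq_mul]
    calc ((2 * s + 2 : ℕ) : ℕ∞) ≤ ((k + 1 : ℕ) : ℕ∞) * 1 := by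
          rw [mul_one]; exact_mod_cast (by omega)
      _ ≤ _ := by gcongr
  rcases lt_or_ge (analyticOrderAt (Y ^ 2) 0) ((2 * s + 2 : ℕ) : ℕ∞) with hlt | hge
  · rw [analyticOrderAt_add_eq_right_of_lt (hlt.trans_le hXo), analyticOrderAt_pow hY,
      nsmul_eq_mul] at hord
    generalize analyticOrderAt Y 0 = b at *
    induction b using ENat.recTopCoe with
    | top =>
      rw [ENat.mul_top (by simp)] at hord
      exact ENat.natCast_ne_top _ hord.symm
    | coe b => norm_cast at hord; omega
  · have := (le_min hXo hge).trans le_analyticOrderAt_add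
    rw [hord] at this
    norm_cast at this
    omega

/-- The singularities of type `D` and `E` are at least triple points. -/
theorem ADEType.three_le_analyticOrderAt (T : ADEType) (hT : ∀ k hk, T ≠ .A k hk) {X Y : ℂ → ℂ}
    (hX : AnalyticAt ℂ X 0) (hY : AnalyticAt ℂ Y 0) (hX1 : 1 ≤ analyticOrderAt X 0)
    (hY1 : 1 ≤ analyticOrderAt Y 0) :
    3 ≤ analyticOrderAt (fun t => T.normalForm (X t, Y t)) 0 := by
  have hmon : ∀ i j : ℕ, 3 ≤ i + j → 3 ≤ analyticOrderAt (X ^ i * Y ^ j) 0 := by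
    intro i j hij
    rw [analyticOrderAt_mul (hX.pow i) (hY.pow j), analyticOrderAt_pow hX, analyticOrderAt_pow hY,
      nsmul_eq_mul, nsmul_eq_mul]
    calc (3 : ℕ∞) ≤ (i : ℕ∞) * 1 + (j : ℕ∞) * 1 := by
          rw [mul_one, mul_one]; exact_mod_cast hij
      _ ≤ _ := by gcongr
  have hsum : ∀ i j i' j' : ℕ, 3 ≤ i + j → 3 ≤ i' + j' →
      3 ≤ analyticOrderAt (X ^ i * Y ^ j + X ^ i' * Y ^ j') 0 := fun i j i' j' h h' =>
    (le_min (hmon i j h) (hmon i' j' h')).trans le_analyticOrderAt_add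
  cases T with
  | A k hk => exact absurd rfl (hT k hk)
  | D k hk =>
    convert hsum 2 1 0 (k - 1) (by omega) (by omega) using 2
    ext t; simp [ADEType.normalForm]
  | E6 =>
    convert hsum 3 0 0 4 (by omega) (by omega) using 2
    ext t; simp [ADEType.normalForm]
  | E7 =>
    convert hsum 3 0 1 3 (by omega) (by omega) using 2
    ext t; simp [ADEType.normalForm]
  | E8 =>
    convert hsum 3 0 0 5 (by omega) (by omega) using 2
    ext t; simp [ADEType.normalForm]

/-- The multiplicities differ: on the `y`-axis `A_k` vanishes to order 2, while D and E germs vanish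
to order at least 3 on every arc through the origin. -/
theorem not_germEquivalent_A_of_forall_ne {k : ℕ} (hk : 1 ≤ k) (T : ADEType)
    (hT : ∀ k hk, T ≠ .A k hk) : ¬ GermEquivalent (ADEType.A k hk).normalForm T.normalForm := by
  intro H
  obtain ⟨L, hL⟩ := H.exists_arc (ADEType.analyticAt_normalForm _)
  obtain ⟨X, Y, hX, hY, hX1, hY1, -, -, he⟩ := hL (fun t => (0, t)) (by fun_prop) (by simp)
  have h3 := T.three_le_analyticOrderAt hT hX hY hX1 hY1
  have h2 : analyticOrderAt (fun t : ℂ => (ADEType.A k hk).normalForm (0, t)) 0 = (2 : ℕ) := by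
    rw [AnalyticAt.analyticOrderAt_eq_natCast]
    · refine ⟨fun _ => 1, by fun_prop, by simp, Filter.Eventually.of_forall fun t => ?_⟩
      simp [ADEType.normalForm]
    · simp only [ADEType.normalForm]
      fun_prop
  rw [← he, h2] at h3
  norm_cast at h3

/-- Along an arc transversal to both coordinate axes, the singularities `D_k`, `k ≥ 5`, and `E_k`
vanish to order exactly three. -/
theorem ADEType.analyticOrderAt_eq_three (T : ADEType) (hT : ∀ k hk, T ≠ .A k hk)
    (hT4 : T ≠ .D 4 le_rfl) {X Y : ℂ → ℂ}
    (hX : AnalyticAt ℂ X 0) (hY : AnalyticAt ℂ Y 0) (hX1 : analyticOrderAt X 0 = 1)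
    (hY1 : analyticOrderAt Y 0 = 1) :
    analyticOrderAt (fun t => T.normalForm (X t, Y t)) 0 = 3 := by
  have hmon : ∀ i j : ℕ, analyticOrderAt (X ^ i * Y ^ j) 0 = (i + j : ℕ) := by
    intro i j
    rw [analyticOrderAt_mul (hX.pow i) (hY.pow j), analyticOrderAt_pow hX, analyticOrderAt_pow hY,
      hX1, hY1]
    simp
  have hsum : ∀ i j i' j' : ℕ, i + j = 3 → 4 ≤ i' + j' →
      analyticOrderAt (X ^ i * Y ^ j + X ^ i' * Y ^ j') 0 = 3 := fun i j i' j' h h' => by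
    rw [analyticOrderAt_add_eq_left_of_lt, hmon, h]
    · rfl
    · rw [hmon, hmon]
      exact_mod_cast (by omega)
  cases T with
  | A k hk => exact absurd rfl (hT k hk)
  | D k hk =>
    have hk4 : k ≠ 4 := by rintro rfl; exact hT4 rfl
    convert hsum 2 1 0 (k - 1) (by omega) (by omega) using 2
    ext t; simp [ADEType.normalForm]
  | E6 =>
    convert hsum 3 0 0 4 (by omega) (by omega) using 2
    ext t; simp [ADEType.normalForm]
  | E7 =>
    convert hsum 3 0 1 3 (by omega) (by omega) using 2
    ext t; simp [ADEType.normalForm]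
  | E8 =>
    convert hsum 3 0 0 5 (by omega) (by omega) using 2
    ext t; simp [ADEType.normalForm]

/-- The form `y (x² + y²)` vanishes on three distinct lines. For the other D and E types, an arc on
which the form vanishes identically must be tangent to a coordinate axis, and an invertible linear
map cannot send three lines onto two. -/
theorem not_germEquivalent_D_four (T : ADEType) (hT : ∀ k hk, T ≠ .A k hk)
    (hT4 : T ≠ .D 4 le_rfl) :
    ¬ GermEquivalent (ADEType.D 4 le_rfl).normalForm T.normalForm := by
  intro H
  obtain ⟨L, hL⟩ := H.exists_arc (ADEType.analyticAt_normalForm _)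
  -- The three lines have slopes 0, `i` and `-i`.
  have key : ∀ c : ℂ, c = 0 ∨ c ^ 2 = -1 → (L (1, c)).1 = 0 ∨ (L (1, c)).2 = 0 := by
    intro c hc
    have hd : HasDerivAt (fun t : ℂ => (t, t * c)) (1, c) 0 := by
      simpa using (hasDerivAt_id (0 : ℂ)).prodMk ((hasDerivAt_id (0 : ℂ)).mul_const c)
    obtain ⟨X, Y, hX, hY, -, -, hXd, hYd, he⟩ :=
      hL (fun t => (t, t * c)) (by fun_prop) (by simp)
    rw [hd.deriv] at hXd hYd
    by_contra! hcon
    rw [T.analyticOrderAt_eq_three hT hT4 hX hY (hXd hcon.1) (hYd hcon.2),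
      analyticOrderAt_eq_top.2] at he
    · exact ENat.natCast_ne_top 3 he.symm
    · refine Filter.Eventually.of_forall fun t => ?_
      rcases hc with rfl | hc
      · simp [ADEType.normalForm]
      · simp only [ADEType.normalForm]
        linear_combination t ^ 3 * c * hc
  have hlin : ∀ c : ℂ, L (1, c) = L (1, 0) + c • L (0, 1) := by
    intro c
    rw [← map_smul, ← map_add]
    simp
  set p := L (1, 0)
  set q := L (0, 1)
  have hI : (0 : ℂ) ≠ Complex.I := Complex.I_ne_zero.symm
  have hI' : (0 : ℂ) ≠ -Complex.I := (neg_ne_zero.2 Complex.I_ne_zero).symm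
  have hII : Complex.I ≠ -Complex.I := self_ne_neg.2 Complex.I_ne_zero
  have hspan : ∀ z : ℂ × ℂ, L z = z.1 • p + z.2 • q := by
    intro z
    rw [← map_smul, ← map_smul, ← map_add]
    simp
  -- A coordinate of `L` that kills two independent vectors is zero, against surjectivity.
  have hfst : ∀ c d : ℂ, c ≠ d → (L (1, c)).1 = 0 → (L (1, d)).1 = 0 → False := by
    intro c d hcd h1 h2
    simp only [hlin, Prod.fst_add, Prod.smul_fst, smul_eq_mul] at h1 h2
    have hq : q.1 = 0 :=
      (mul_eq_zero.1 (by linear_combination h1 - h2 : (c - d) * q.1 = 0)).resolve_left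
        (sub_ne_zero.2 hcd)
    have hp : p.1 = 0 := by simpa [hq] using h1
    have := congrArg Prod.fst ((L.apply_symm_apply (1, 0)).symm.trans (hspan _))
    simp [hp, hq] at this
  have hsnd : ∀ c d : ℂ, c ≠ d → (L (1, c)).2 = 0 → (L (1, d)).2 = 0 → False := by
    intro c d hcd h1 h2
    simp only [hlin, Prod.snd_add, Prod.smul_snd, smul_eq_mul] at h1 h2
    have hq : q.2 = 0 :=
      (mul_eq_zero.1 (by linear_combination h1 - h2 : (c - d) * q.2 = 0)).resolve_left
        (sub_ne_zero.2 hcd)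
    have hp : p.2 = 0 := by simpa [hq] using h1
    have := congrArg Prod.snd ((L.apply_symm_apply (0, 1)).symm.trans (hspan _))
    simp [hp, hq] at this
  rcases key 0 (by simp) with h0 | h0 <;> rcases key Complex.I (by simp) with h1 | h1 <;>
    rcases key (-Complex.I) (by simp) with h2 | h2
  · exact hfst _ _ hI h0 h1
  · exact hfst _ _ hI h0 h1
  · exact hfst _ _ hI' h0 h2
  · exact hsnd _ _ hII h1 h2
  · exact hfst _ _ hII h1 h2
  · exact hsnd _ _ hI' h0 h2
  · exact hsnd _ _ hI h0 h1
  · exact hsnd _ _ hI h0 h1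

/-! ### Uniqueness of the type for nodes, tacnodes and ordinary triple points -/

theorem HasType.eq_A_one {F : MvPolynomial (Fin 3) ℂ} {p : ℙ ℂ (Fin 3 → ℂ)} {T : ADEType}
    (hT : HasType F p T) (h : HasType F p (.A 1 le_rfl)) : T = .A 1 le_rfl := by
  have H := GermEquivalent.of_common h hT
  by_cases hA : ∀ k hk, T ≠ .A k hk
  · exact absurd H (not_germEquivalent_A_of_forall_ne _ T hA)
  · push Not at hA
    obtain ⟨k, hk, rfl⟩ := hA
    rcases Nat.even_or_odd k with he | ⟨c, rfl⟩
    · exact absurd H (not_germEquivalent_A_even (s := 1) le_rfl hk he)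
    · rcases Nat.eq_zero_or_pos c with rfl | hc
      · rfl
      · exact absurd H (not_germEquivalent_A_of_lt (s := 1) le_rfl hk (by omega))

theorem HasType.eq_A_three {F : MvPolynomial (Fin 3) ℂ} {p : ℙ ℂ (Fin 3 → ℂ)} {T : ADEType}
    (hT : HasType F p T) (h : HasType F p (.A 3 (by norm_num))) : T = .A 3 (by norm_num) := by
  have H := GermEquivalent.of_common h hT
  by_cases hA : ∀ k hk, T ≠ .A k hk
  · exact absurd H (not_germEquivalent_A_of_forall_ne _ T hA)
  · push Not at hA
    obtain ⟨k, hk, rfl⟩ := hA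
    rcases Nat.even_or_odd k with he | ⟨c, rfl⟩
    · exact absurd H (not_germEquivalent_A_even (s := 2) one_le_two hk he)
    · obtain rfl | rfl | hc : c = 0 ∨ c = 1 ∨ 2 ≤ c := by omega
      -- The case A₁ is below the range of the perturbed arc; uniqueness for nodes covers it with
      -- the roles exchanged.
      · exact (h.eq_A_one hT).symm
      · rfl
      · exact absurd H (not_germEquivalent_A_of_lt (s := 2) one_le_two hk (by omega))

theorem HasType.eq_D_four {F : MvPolynomial (Fin 3) ℂ} {p : ℙ ℂ (Fin 3 → ℂ)} {T : ADEType}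
    (hT : HasType F p T) (h : HasType F p (.D 4 le_rfl)) : T = .D 4 le_rfl := by
  by_cases hA : ∀ k hk, T ≠ .A k hk
  · by_contra hT4
    exact not_germEquivalent_D_four T hA hT4 (GermEquivalent.of_common h hT)
  · push Not at hA
    obtain ⟨k, hk, rfl⟩ := hA
    exact absurd (GermEquivalent.of_common hT h)
      (not_germEquivalent_A_of_forall_ne _ _ (by simp))

theorem HasType.mkNumberAt_eq {F : MvPolynomial (Fin 3) ℂ} {p : ℙ ℂ (Fin 3 → ℂ)} {T : ADEType}
    (hT : HasType F p T) (huniq : ∀ T', HasType F p T' → T' = T) :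
    mkNumberAt F p = T.mkNumber := by
  have hex : ∃ T, HasType F p T := ⟨T, hT⟩
  rw [mkNumberAt, dif_pos hex, huniq _ hex.choose_spec]

/-! ### The numbers `m` of nodes, tacnodes and ordinary triple points -/

/-- All exceptional curves are (-2)-curves, so the right-hand side of adjunction vanishes. -/
theorem ADEType.localCanonical_eq_zero (T : ADEType) : localCanonical T.intersectionMatrix = 0 := by
  have hdiag : ∀ j, T.intersectionMatrix j j = -2 := by
    cases T <;> intro j
    · exact congrArg Neg.neg (congrFun (CartanMatrix.A_diag _) j)
    · exact congrArg Neg.neg (CartanMatrix.D_diag _ j)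
    · exact congrArg Neg.neg (CartanMatrix.E₆_diag j)
    · exact congrArg Neg.neg (CartanMatrix.E₇_diag j)
    · exact congrArg Neg.neg (CartanMatrix.E₈_diag j)
  have : (fun j => -2 - (T.intersectionMatrix j j : ℚ)) = 0 := by
    ext j
    simp [hdiag]
  rw [localCanonical, this, Matrix.mulVec_zero]

theorem ADEType.mkNumber_eq (T : ADEType) :
    T.mkNumber = 3 * ((eulerChar T.intersectionMatrix : ℚ) - 1 / (Nat.card T.smallGroup : ℚ)) := by
  simp [ADEType.mkNumber, miyaokaKobayashi, localCanonicalSq, T.localCanonical_eq_zero]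

theorem ADEType.eulerChar_A_one : eulerChar (ADEType.A 1 le_rfl).intersectionMatrix = 2 := by
  decide

theorem ADEType.eulerChar_A_three :
    eulerChar (ADEType.A 3 (by norm_num)).intersectionMatrix = 4 := by
  decide

theorem ADEType.eulerChar_D_four : eulerChar (ADEType.D 4 le_rfl).intersectionMatrix = 5 := by
  decide

theorem ADEType.card_smallGroup_A_one : Nat.card (ADEType.A 1 le_rfl).smallGroup = 2 := by
  have hm : rotationMatrix (1 + 1) = -1 := by
    have h : 2 * (Real.pi : ℂ) * Complex.I / ((1 + 1 : ℕ) : ℂ) = Real.pi * Complex.I := by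
      push_cast; ring
    rw [rotationMatrix, h, Complex.exp_neg, Complex.exp_pi_mul_I, ← Matrix.one_fin_two.symm]
    ext i j; fin_cases i <;> fin_cases j <;> norm_num
  have hs : {g : Matrix.GeneralLinearGroup (Fin 2) ℂ | (g : Matrix (Fin 2) (Fin 2) ℂ) ∈
      (ADEType.A 1 le_rfl).groupGenerators} = {-1} := by
    ext g
    simp only [ADEType.groupGenerators, hm, Set.mem_ofPred_eq, Set.mem_singleton_iff, Units.ext_iff,
      Units.val_neg, Units.val_one]
  rw [ADEType.smallGroup, hs, ← Subgroup.zpowers_eq_closure, Nat.card_zpowers]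
  refine orderOf_eq_prime (by simp) fun h => ?_
  have := congrArg (fun g : Matrix.GeneralLinearGroup (Fin 2) ℂ => g.val 0 0) h
  norm_num at this

/-- The matrix `diag(i, -i)`. -/
def diagI : Matrix.GeneralLinearGroup (Fin 2) ℂ where
  val := !![Complex.I, 0; 0, -Complex.I]
  inv := !![-Complex.I, 0; 0, Complex.I]
  val_inv := by ext i j; fin_cases i <;> fin_cases j <;> simp
  inv_val := by ext i j; fin_cases i <;> fin_cases j <;> simp

/-- The quaternion `j` as a complex matrix. -/
def quaternionJ : Matrix.GeneralLinearGroup (Fin 2) ℂ where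
  val := !![0, 1; -1, 0]
  inv := !![0, -1; 1, 0]
  val_inv := by ext i j; fin_cases i <;> fin_cases j <;> simp
  inv_val := by ext i j; fin_cases i <;> fin_cases j <;> simp

/-- Serves both A₃, where `k + 1 = 4`, and D₄, where `2 (k - 2) = 4`. -/
theorem rotationMatrix_four : rotationMatrix 4 = (diagI : Matrix (Fin 2) (Fin 2) ℂ) := by
  have h : 2 * (Real.pi : ℂ) * Complex.I / ((4 : ℕ) : ℂ) = Real.pi / 2 * Complex.I := by
    push_cast; ring
  rw [rotationMatrix, h, Complex.exp_neg, Complex.exp_pi_div_two_mul_I, Complex.inv_I]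
  rfl

theorem quaternionMatrix_j :
    quaternionMatrix 0 0 1 0 = (quaternionJ : Matrix (Fin 2) (Fin 2) ℂ) := by
  simp [quaternionMatrix, quaternionJ]

theorem diagI_mul_diagI : diagI * diagI = -1 := by
  ext i j; fin_cases i <;> fin_cases j <;> simp [diagI]

theorem quaternionJ_mul_quaternionJ : quaternionJ * quaternionJ = -1 := by
  ext i j; fin_cases i <;> fin_cases j <;> simp [quaternionJ]

theorem quaternionJ_mul_diagI : quaternionJ * diagI = -(diagI * quaternionJ) := by
  ext i j; fin_cases i <;> fin_cases j <;> simp [quaternionJ, diagI]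

theorem ADEType.card_smallGroup_A_three :
    Nat.card (ADEType.A 3 (by norm_num)).smallGroup = 4 := by
  have hs : {g : Matrix.GeneralLinearGroup (Fin 2) ℂ | (g : Matrix (Fin 2) (Fin 2) ℂ) ∈
      (ADEType.A 3 (by norm_num)).groupGenerators} = {diagI} := by
    ext g
    simp [ADEType.groupGenerators, rotationMatrix_four, Units.ext_iff]
  rw [ADEType.smallGroup, hs, ← Subgroup.zpowers_eq_closure, Nat.card_zpowers]
  refine orderOf_eq_prime_pow (p := 2) (n := 1) (fun h => ?_) ?_
  · rw [pow_one, pow_two, diagI_mul_diagI] at h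
    have := congrArg (fun g : Matrix.GeneralLinearGroup (Fin 2) ℂ => g.val 0 0) h
    norm_num at this
  · rw [one_add_one_eq_two, pow_two 2, pow_mul, pow_two diagI, diagI_mul_diagI]
    simp

/-- The quaternion group, with its eight elements listed. -/
def quaternionSubgroup : Subgroup (Matrix.GeneralLinearGroup (Fin 2) ℂ) where
  carrier := {1, -1, diagI, -diagI, quaternionJ, -quaternionJ, diagI * quaternionJ,
    -(diagI * quaternionJ)}
  one_mem' := by simp
  mul_mem' := by
    have h1 : ∀ g, diagI * (diagI * g) = -g := fun g => by
      rw [← mul_assoc, diagI_mul_diagI, neg_one_mul]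
    have h3 : ∀ g, quaternionJ * (diagI * g) = -(diagI * (quaternionJ * g)) := fun g => by
      rw [← mul_assoc, quaternionJ_mul_diagI, neg_mul, mul_assoc]
    rintro a b (rfl | rfl | rfl | rfl | rfl | rfl | rfl | rfl)
      (rfl | rfl | rfl | rfl | rfl | rfl | rfl | rfl) <;>
      simp [mul_assoc, diagI_mul_diagI, quaternionJ_mul_quaternionJ, quaternionJ_mul_diagI,
        h1, h3]
  inv_mem' := by
    have h1 : diagI⁻¹ = -diagI := inv_eq_of_mul_eq_one_right (by simp [diagI_mul_diagI])
    have h2 : quaternionJ⁻¹ = -quaternionJ :=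
      inv_eq_of_mul_eq_one_right (by simp [quaternionJ_mul_quaternionJ])
    rintro a (rfl | rfl | rfl | rfl | rfl | rfl | rfl | rfl) <;>
      simp [inv_neg, h1, h2, quaternionJ_mul_diagI]

theorem card_quaternionSubgroup : Nat.card quaternionSubgroup = 8 := by
  -- The first row already distinguishes the eight matrices, so counting reduces to pairs of complex
  -- numbers.
  have hset : ((fun g : Matrix.GeneralLinearGroup (Fin 2) ℂ => (g.val 0 0, g.val 0 1)) ''
      (quaternionSubgroup : Set _)) = (({(1, 0), (-1, 0), (Complex.I, 0), (-Complex.I, 0), (0, 1),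
        (0, -1), (0, Complex.I), (0, -Complex.I)} : Finset (ℂ × ℂ)) : Set (ℂ × ℂ)) := by
    simp [quaternionSubgroup, Set.image_insert_eq, diagI, quaternionJ]
  have hinj : Set.InjOn (fun g : Matrix.GeneralLinearGroup (Fin 2) ℂ => (g.val 0 0, g.val 0 1))
      (quaternionSubgroup : Set _) := by
    rintro a (rfl | rfl | rfl | rfl | rfl | rfl | rfl | rfl) b
      (rfl | rfl | rfl | rfl | rfl | rfl | rfl | rfl) <;>
      simp [diagI, quaternionJ, Complex.ext_iff] <;> norm_num
  rw [← SetLike.coe_sort_coe, Nat.card_coe_set_eq, ← hinj.ncard_image, hset,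
    Set.ncard_coe_finset]
  repeat rw [Finset.card_insert_of_notMem
    (by simp [Complex.ext_iff]; try norm_num)]
  simp

theorem ADEType.smallGroup_D_four : (ADEType.D 4 le_rfl).smallGroup = quaternionSubgroup := by
  have hs : {g : Matrix.GeneralLinearGroup (Fin 2) ℂ | (g : Matrix (Fin 2) (Fin 2) ℂ) ∈
      (ADEType.D 4 le_rfl).groupGenerators} = {diagI, quaternionJ} := by
    ext g
    simp [ADEType.groupGenerators, rotationMatrix_four, quaternionMatrix_j, Units.ext_iff]
  rw [ADEType.smallGroup, hs]
  refine le_antisymm ?_ ?_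
  · rw [Subgroup.closure_le]
    rintro g (rfl | rfl) <;> simp [quaternionSubgroup]
  · set H := Subgroup.closure {diagI, quaternionJ}
    have hi : diagI ∈ H := Subgroup.subset_closure (by simp)
    have hj : quaternionJ ∈ H := Subgroup.subset_closure (by simp)
    have hn : -1 ∈ H := diagI_mul_diagI ▸ H.mul_mem hi hi
    have hneg : ∀ g ∈ H, -g ∈ H := fun g hg => by simpa using H.mul_mem hn hg
    rintro g (rfl | rfl | rfl | rfl | rfl | rfl | rfl | rfl)
    exacts [H.one_mem, hn, hi, hneg _ hi, hj, hneg _ hj, H.mul_mem hi hj,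
      hneg _ (H.mul_mem hi hj)]

theorem ADEType.mkNumber_A_one : (ADEType.A 1 le_rfl).mkNumber = 9 / 2 := by
  rw [ADEType.mkNumber_eq, ADEType.eulerChar_A_one, ADEType.card_smallGroup_A_one]
  norm_num

theorem ADEType.mkNumber_A_three : (ADEType.A 3 (by norm_num)).mkNumber = 45 / 4 := by
  rw [ADEType.mkNumber_eq, ADEType.eulerChar_A_three, ADEType.card_smallGroup_A_three]
  norm_num

theorem ADEType.mkNumber_D_four : (ADEType.D 4 le_rfl).mkNumber = 117 / 8 := by
  rw [ADEType.mkNumber_eq, ADEType.eulerChar_D_four, ADEType.smallGroup_D_four,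
    card_quaternionSubgroup]
  norm_num

/-- The numbers `m` of the three types are integral multiples of `9 / 8`. -/
theorem exists_mkNumberAt_eq {F : MvPolynomial (Fin 3) ℂ} {p : ℙ ℂ (Fin 3 → ℂ)}
    (h : IsNode F p ∨ IsTacnode F p ∨ IsOrdinaryTriplePoint F p) :
    ∃ m : ℤ, 8 * mkNumberAt F p = 9 * m := by
  rcases h with h | h | h
  · refine ⟨4, ?_⟩
    rw [HasType.mkNumberAt_eq h fun T hT => hT.eq_A_one h, ADEType.mkNumber_A_one]
    norm_num
  · refine ⟨10, ?_⟩
    rw [HasType.mkNumberAt_eq h fun T hT => hT.eq_A_three h, ADEType.mkNumber_A_three]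
    norm_num
  · refine ⟨13, ?_⟩
    rw [HasType.mkNumberAt_eq h fun T hT => hT.eq_D_four h, ADEType.mkNumber_D_four]
    norm_num

end MKCurve

theorem mainTheorem12 :
    (¬ ∃ F : MvPolynomial (Fin 3) ℂ, MKCurve.IsMKCurve F 10 ∧
      ∀ p ∈ MKCurve.singularPoints F,
        MKCurve.IsNode F p ∨ MKCurve.IsTacnode F p ∨ MKCurve.IsOrdinaryTriplePoint F p) ∧
    ¬ ∃ n₁ n₃ d₄ : ℕ,
      (9 / 2 : ℚ) * n₁ + (45 / 4 : ℚ) * n₃ + (117 / 8 : ℚ) * d₄ = 220 := by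
  constructor
  · rintro ⟨F, hF, hsing⟩
    obtain ⟨m, hm⟩ : ∃ m : ℤ,
        8 * (∑ᶠ p ∈ MKCurve.singularPoints F, MKCurve.mkNumberAt F p) = 9 * m := by
      -- Finiteness of the singular locus is not needed: the default value 0 of an infinite sum is
      -- also a multiple of 9/8.
      refine finsum_mem_induction (fun x : ℚ => ∃ m : ℤ, 8 * x = 9 * m) ⟨0, by simp⟩ ?_
        fun p hp => MKCurve.exists_mkNumberAt_eq (hsing p hp)
      rintro x y ⟨a, ha⟩ ⟨b, hb⟩
      exact ⟨a + b, by push_cast; linear_combination ha + hb⟩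
    rw [hF.sum_eq] at hm
    norm_num at hm
    have : (1760 : ℤ) = 9 * m := by exact_mod_cast hm
    omega
  · rintro ⟨n₁, n₃, d₄, h⟩
    -- After clearing denominators all coefficients on the left are divisible by 9, and 1760 is not.
    have : (36 * n₁ + 90 * n₃ + 117 * d₄ : ℚ) = 1760 := by linear_combination 8 * h
    norm_cast at this
    omega
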